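/- Let $n, m \ge 0$ be integers, let $\mathbb{R}^n$, $\mathbb{R}^m$ carry the Euclidean norm, and consider, for $t \ge 0$, the problem of minimizing $\hat f(x - c(t))$ over $\hat{\mathcal X}(t) := \{x \in \mathbb{R}^n : Ux \le v(t)\}$ (componentwise inequality). Let $\alpha, \omega > 0$ and $\beta, \ell_c, \ell_v \ge 0$, and assume: (i) $\hat f : \mathbb{R}^n \to \mathbb{R}$ is twice continuously differentiable and $\alpha$-strongly convex, and $\nabla \hat f$ is $\beta$-Lipschitz; (ii) $c : \mathbb{R}_{\ge 0} \to \mathbb{R}^n$ and $v : \mathbb{R}_{\ge 0} \to \mathbb{R}^m$ are $\ell_c$- and $\ell_v$-Lipschitz, respectively; (iii) $U \in \mathbb{R}^{m \times n}$, and for every $t \ge 0$ and every $x \in \hat{\mathcal X}(t)$ one has $\omega^2 \mathbb{I} \preceq U_I U_I^\top$, where $I = \{ i : (Ux)_i = v_i(t) \}$ and $U_I$ is the matrix of the rows of $U$ with index in $I$; (iv) $\hat{\mathcal X}(t) \neq \emptyset$ for every $t \ge 0$. For a convex set $X$ and $x \in X$ let $N_x X := \operatorname{cl}\{\eta : \langle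 \eta, y - x\rangle \le 0 \text{ for all } y \in X\}$. A complete solution of the sweeping gradient flow $$\dot x(t) \in -\nabla \hat f(x(t) - c(t)) - N_{x(t)} \hat{\mathcal X}(t) \qquad (*)$$ is a map $x : \mathbb{R}_{\ge 0} \to \mathbb{R}^n$ that, on every interval $[0, T]$ with $T > 0$, is absolutely continuous, satisfies $(*)$ for almost every $t$, and satisfies $x(t) \in \hat{\mathcal X}(t)$ for all $t$. Then for every $t \ge 0$ the problem has a unique optimizer $x^\star(t)$; for every $x_0 \in \hat{\mathcal X}(0)$ there is a complete solution of $(*)$ with $x(0) = x_0$; and every complete solution $x$ of $(*)$ satisfies $$\limsup_{t \to \infty} \|x(t) - x^\star(t)\| \le R := \frac{\beta^{1/2}}{\alpha^{3/2}} \left( \frac{\beta \ell_c}{\alpha} + \frac{\ell_v}{\omega} \right).$$ Furthermore, if $\|x(s) - x^\star(s)\| \le R$ for some $s \ge 0$ (in particular for $s = 0$), then $\|x(t) - x^\star(t)\| \le R$ for all $t \ge s$. -/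

import Mathlib

open Set Filter Topology MeasureTheory
open scoped NNReal Matrix Gradient

/-- The normal cone of a convex set `X` at a point `x` of `X`:
the closure of `{η | ∀ y ∈ X, ⟪η, y - x⟫ ≤ 0}`. -/
def normalCone {n : ℕ} (X : Set (EuclideanSpace ℝ (Fin n))) (x : EuclideanSpace ℝ (Fin n)) :
    Set (EuclideanSpace ℝ (Fin n)) :=
  closure {η | ∀ y ∈ X, inner ℝ η (y - x) ≤ 0}

/-- `x` is a solution on `[0, T]` of the perturbed sweeping process
`ẋ(t) ∈ Φ (x t) t - N_{x t} X(t)`: it is absolutely continuous on `[0, T]`, it stays in the moving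
set, and the inclusion holds at almost every time. Values of `x` outside `[0, T]` are irrelevant
(the two endpoints form a null set). -/
structure IsSweepingSolution {n : ℕ}
    (Φ : EuclideanSpace ℝ (Fin n) → ℝ → EuclideanSpace ℝ (Fin n))
    (X : ℝ → Set (EuclideanSpace ℝ (Fin n))) (T : ℝ) (x : ℝ → EuclideanSpace ℝ (Fin n)) :
    Prop where
  absolutelyContinuous : AbsolutelyContinuousOnInterval x 0 T
  mem : ∀ t ∈ Icc 0 T, x t ∈ X t
  inclusion : ∀ᵐ t ∂(volume.restrict (Icc 0 T)),
    ∃ η ∈ normalCone (X t) (x t), HasDerivAt x (Φ (x t) t - η) t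

/-- A complete solution: its restriction to `[0, T]` is a solution for every `T > 0`. -/
def IsCompleteSweepingSolution {n : ℕ}
    (Φ : EuclideanSpace ℝ (Fin n) → ℝ → EuclideanSpace ℝ (Fin n))
    (X : ℝ → Set (EuclideanSpace ℝ (Fin n))) (x : ℝ → EuclideanSpace ℝ (Fin n)) : Prop :=
  ∀ T : ℝ, 0 < T → IsSweepingSolution Φ X T x

/-- The polyhedron `{x | U x ≤ w}` (componentwise inequality). -/
def polyhedron {m n : ℕ} (U : Matrix (Fin m) (Fin n) ℝ) (w : EuclideanSpace ℝ (Fin m)) :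
    Set (EuclideanSpace ℝ (Fin n)) :=
  {x | ∀ i, (U *ᵥ x.ofLp) i ≤ w i}

/-- The active constraints at `x` of the system `U x ≤ w`. -/
def activeSet {m n : ℕ} (U : Matrix (Fin m) (Fin n) ℝ) (w : EuclideanSpace ℝ (Fin m))
    (x : EuclideanSpace ℝ (Fin n)) : Set (Fin m) :=
  {i | (U *ᵥ x.ofLp) i = w i}

/-- The matrix `U_I` of the rows of `U` with index in `I`. -/
def rowsOf {m n : ℕ} (U : Matrix (Fin m) (Fin n) ℝ) (I : Set (Fin m)) : Matrix I (Fin n) ℝ :=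
  U.submatrix Subtype.val id

/-- `x` is a (global) minimizer of `f` over `X`. -/
def IsOptimizer {n : ℕ} (f : EuclideanSpace ℝ (Fin n) → ℝ)
    (X : Set (EuclideanSpace ℝ (Fin n))) (x : EuclideanSpace ℝ (Fin n)) : Prop :=
  x ∈ X ∧ ∀ y ∈ X, f x ≤ f y

/-! The distance `e` from a solution to the current optimizer satisfies `e' ≤ K - α e` almost
everywhere, where `K = √(β/α) (β ℓc / α + ℓv / ω)` bounds the speed of the optimizer. Hence `exp (α
t) (e - K / α)` is nonincreasing, and `K / α` is exactly `R`; the limsup bound and the invariance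
both follow (`exp_mul_norm_sub_le`). The decay rate `α` comes from strong monotonicity of the
gradient, since the normal cone term has the favourable sign.

For the speed of the optimizer, the dependence on `c` and on `v` is separated. A change of shift
costs a factor `β / α`, by comparing two variational inequalities over one set. A change of
right-hand side is handled by `eventually_exists_shift`: a vector `d` with `‖d‖ ≤ ‖Δv‖ / ω` moves
the active constraints to their new positions. Testing both variational inequalities along `d` gives
`⟪Δg, Δz⟫ ≤ ‖Δg‖ ‖d‖`, and cocoercivity (Baillon-Haddad) turns this into `‖Δz‖ ≤ √(β/α) ‖d‖`, better
than the factor `β / α` given by the Lipschitz bound alone (`norm_sub_le_of_variationalInequality`).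

Existence uses Moreau's catching-up scheme. Its iterates satisfy an evolution variational inequality
with an error quadratic in elapsed time; this passes to pointwise limits, and dividing by the
elapsed time at a point of differentiability yields the inclusion. The moving set is Lipschitz
because projecting a fixed point is itself such a variational inequality. -/

/-! ### Convex functions with Lipschitz gradient. -/

section ConvexAnalysis

variable {E : Type*} [NormedAddCommGroup E] [InnerProductSpace ℝ E] [CompleteSpace E]
  {f : E → ℝ} {α : ℝ} {β : ℝ≥0}

lemma hasDerivAt_comp_line (hf : Differentiable ℝ f) (x d : E) (t : ℝ) :
    HasDerivAt (fun s : ℝ => f (x + s • d)) (inner ℝ (∇ f (x + t • d)) d) t := by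
  have h1 := (hf (x + t • d)).hasGradientAt.hasFDerivAt
  have h2 : HasDerivAt (fun s : ℝ => x + s • d) d t := by
    simpa using ((hasDerivAt_id t).smul_const d).const_add x
  exact h1.comp_hasDerivAt t h2

/-- The descent lemma for functions with Lipschitz gradient. -/
lemma le_add_inner_gradient_add_sq (hf : Differentiable ℝ f) (hβ : LipschitzWith β (∇ f))
    (x y : E) : f y ≤ f x + inner ℝ (∇ f x) (y - x) + β / 2 * ‖y - x‖ ^ 2 := by
  set d := y - x with hd
  have hderiv : ∀ t : ℝ, HasDerivAt
      (fun s : ℝ => f (x + s • d) - s * inner ℝ (∇ f x) d - β / 2 * ‖d‖ ^ 2 * s ^ 2)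
      (inner ℝ (∇ f (x + t • d)) d - inner ℝ (∇ f x) d - β * ‖d‖ ^ 2 * t) t := by
    intro t
    have h1 := hasDerivAt_comp_line hf x d t
    have h2 := (hasDerivAt_id t).mul_const (inner ℝ (∇ f x) d)
    have h3 := (hasDerivAt_pow 2 t).const_mul (β / 2 * ‖d‖ ^ 2)
    refine ((h1.sub h2).sub h3).congr_deriv ?_
    norm_num
    ring
  have hanti : AntitoneOn
      (fun s : ℝ => f (x + s • d) - s * inner ℝ (∇ f x) d - β / 2 * ‖d‖ ^ 2 * s ^ 2)
      (Icc 0 1) := by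
    refine antitoneOn_of_deriv_nonpos (convex_Icc 0 1)
      (fun t _ => (hderiv t).continuousAt.continuousWithinAt)
      (fun t _ => (hderiv t).differentiableAt.differentiableWithinAt) fun t ht => ?_
    rw [interior_Icc] at ht
    rw [(hderiv t).deriv, ← inner_sub_left]
    have h1 := real_inner_le_norm (∇ f (x + t • d) - ∇ f x) d
    have h2 := hβ.dist_le_mul (x + t • d) x
    rw [dist_eq_norm, dist_eq_norm, add_sub_cancel_left, norm_smul, Real.norm_of_nonneg ht.1.le]
      at h2
    nlinarith [mul_le_mul_of_nonneg_right h2 (norm_nonneg d)]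
  have := hanti (left_mem_Icc.2 zero_le_one) (right_mem_Icc.2 zero_le_one) zero_le_one
  simp only [one_smul, zero_smul, add_zero, hd, add_sub_cancel] at this
  linarith

/-- The first order condition for a minimum over a convex set. -/
lemma inner_gradient_nonneg_of_isMinOn (hf : Differentiable ℝ f) {X : Set E} (hX : Convex ℝ X)
    {x y : E} (hx : x ∈ X) (hmin : ∀ z ∈ X, f x ≤ f z) (hy : y ∈ X) :
    0 ≤ inner ℝ (∇ f x) (y - x) := by
  have h := hasDerivAt_comp_line hf x (y - x) 0
  simp only [zero_smul, add_zero] at h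
  refine ge_of_tendsto h.tendsto_slope_zero_right ?_
  filter_upwards [Ioo_mem_nhdsGT (zero_lt_one' ℝ)] with t ht
  have := hmin _ (hX.add_smul_sub_mem hx hy ⟨ht.1.le, ht.2.le⟩)
  simp only [zero_add, zero_smul, add_zero, smul_eq_mul]
  exact mul_nonneg (inv_nonneg.2 ht.1.le) (by linarith)

/-- Divide the strong convexity inequality on the segment from `x` to `y` by the step and let the
step tend to `0` from the right. -/
lemma StrongConvexOn.add_inner_gradient_add_sq_le (hf : Differentiable ℝ f)
    (hα : StrongConvexOn univ α f) (x y : E) :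
    f x + inner ℝ (∇ f x) (y - x) + α / 2 * ‖y - x‖ ^ 2 ≤ f y := by
  have h := hasDerivAt_comp_line hf x (y - x) 0
  simp only [zero_smul, add_zero] at h
  have h1 : Tendsto (fun t : ℝ => f y - f x - (1 - t) * (α / 2 * ‖y - x‖ ^ 2)) (𝓝[>] 0)
      (𝓝 (f y - f x - (1 - 0) * (α / 2 * ‖y - x‖ ^ 2))) :=
    (Continuous.tendsto (by fun_prop) 0).mono_left nhdsWithin_le_nhds
  have := le_of_tendsto_of_tendsto h.tendsto_slope_zero_right h1 (by
    filter_upwards [Ioo_mem_nhdsGT (zero_lt_one' ℝ)] with t ht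
    have h2 := hα.2 (mem_univ y) (mem_univ x) ht.1.le (sub_nonneg.2 ht.2.le) (by ring)
    have h3 : t • y + (1 - t) • x = x + t • (y - x) := by module
    rw [h3] at h2
    simp only [zero_add, zero_smul, add_zero, smul_eq_mul] at h2 ⊢
    rw [inv_mul_le_iff₀ ht.1]
    linarith)
  linarith

lemma StrongConvexOn.strongly_monotone_gradient (hf : Differentiable ℝ f)
    (hα : StrongConvexOn univ α f) (x y : E) :
    α * ‖x - y‖ ^ 2 ≤ inner ℝ (∇ f x - ∇ f y) (x - y) := by
  have h1 := hα.add_inner_gradient_add_sq_le hf x y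
  have h2 := hα.add_inner_gradient_add_sq_le hf y x
  rw [norm_sub_rev y x, ← neg_sub x y, inner_neg_right] at h1
  rw [inner_sub_left]
  linarith

/-- The Baillon-Haddad theorem: a Lipschitz gradient of a convex function is cocoercive. -/
lemma sq_norm_gradient_sub_le (hf : Differentiable ℝ f)
    (hconv : StrongConvexOn univ 0 f) (hβ : LipschitzWith β (∇ f)) (x y : E) :
    ‖∇ f x - ∇ f y‖ ^ 2 ≤ β * inner ℝ (∇ f x - ∇ f y) (x - y) := by
  rcases eq_or_ne β 0 with rfl | hβ0
  · have := hβ.dist_le_mul x y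
    rw [dist_eq_norm] at this
    simp only [NNReal.coe_zero, zero_mul] at this ⊢
    simp [le_antisymm this (norm_nonneg _)]
  have hpos : (0 : ℝ) < β := by positivity
  have key : ∀ x y : E,
      f x + inner ℝ (∇ f x) (y - x) + ‖∇ f x - ∇ f y‖ ^ 2 / (2 * β) ≤ f y := by
    intro x y
    -- The point `y + β⁻¹ w` minimizes the descent-lemma upper bound at `y` for `f - ⟪∇ f x, ·⟫`;
    -- the convexity lower bound from `x` is evaluated at the same point.
    set w := ∇ f x - ∇ f y with hw
    have h1 := hconv.add_inner_gradient_add_sq_le hf x (y + (β : ℝ)⁻¹ • w)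
    have h2 := le_add_inner_gradient_add_sq hf hβ y (y + (β : ℝ)⁻¹ • w)
    rw [add_sub_cancel_left, norm_smul, inner_smul_right, norm_inv, Real.norm_of_nonneg hpos.le]
      at h2
    rw [add_sub_right_comm, inner_add_right, inner_smul_right] at h1
    have h3 : inner ℝ (∇ f x) w - inner ℝ (∇ f y) w = ‖w‖ ^ 2 := by
      rw [← inner_sub_left, ← hw, real_inner_self_eq_norm_sq]
    have h4 : (β : ℝ)⁻¹ * inner ℝ (∇ f x) w = (β : ℝ)⁻¹ * inner ℝ (∇ f y) w + (β : ℝ)⁻¹ * ‖w‖ ^ 2 := by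
      rw [← h3]; ring
    have h5 : (β : ℝ) / 2 * ((β : ℝ)⁻¹ * ‖w‖) ^ 2 = ‖w‖ ^ 2 / (2 * β) := by field_simp
    have h6 : (β : ℝ)⁻¹ * ‖w‖ ^ 2 = ‖w‖ ^ 2 / (2 * β) + ‖w‖ ^ 2 / (2 * β) := by field_simp; norm_num
    linarith
  have h1 := key x y
  have h2 := key y x
  rw [norm_sub_rev] at h2
  rw [← neg_sub x y, inner_neg_right] at h1
  have h3 : ‖∇ f x - ∇ f y‖ ^ 2 / (2 * β) + ‖∇ f x - ∇ f y‖ ^ 2 / (2 * β)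
      ≤ inner ℝ (∇ f x - ∇ f y) (x - y) := by
    rw [inner_sub_left]; linarith
  have h4 : ‖∇ f x - ∇ f y‖ ^ 2
      = β * (‖∇ f x - ∇ f y‖ ^ 2 / (2 * β) + ‖∇ f x - ∇ f y‖ ^ 2 / (2 * β)) := by field_simp; norm_num
  rw [h4]
  gcongr

/-- Strongly convex functions attain their minimum on nonempty closed sets. -/
lemma StrongConvexOn.exists_forall_le [ProperSpace E] (hf : Differentiable ℝ f) (h0 : 0 < α)
    (hα : StrongConvexOn univ α f) {X : Set E} (hX : IsClosed X) (hne : X.Nonempty) :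
    ∃ x ∈ X, ∀ y ∈ X, f x ≤ f y := by
  obtain ⟨x₀, hx₀⟩ := hne
  refine hf.continuous.continuousOn.exists_isMinOn' hX hx₀ (Filter.Eventually.filter_mono inf_le_left ?_)
  rw [← Metric.cobounded_eq_cocompact]
  -- Beyond this radius the quadratic term dominates the linear one, so `f y ≥ f x₀`.
  filter_upwards [(Metric.tendsto_dist_right_cobounded_atTop x₀).eventually_ge_atTop
    (2 * ‖∇ f x₀‖ / α)] with y hy
  have h1 := hα.add_inner_gradient_add_sq_le hf x₀ y
  have h2 := abs_le.1 (abs_real_inner_le_norm (∇ f x₀) (y - x₀))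
  rw [dist_eq_norm, div_le_iff₀ h0] at hy
  nlinarith [norm_nonneg (y - x₀)]

end ConvexAnalysis

/-! ### Perturbation of polyhedra under a uniform rank condition. -/

/-- A matrix whose Gram matrix is bounded below by `ω ^ 2` has a right inverse bounded by `1 / ω`. -/
lemma exists_mulVec_eq_of_posSemidef_sub {ι : Type*} [Finite ι] [DecidableEq ι] {n : ℕ} {ω : ℝ}
    (hω : 0 < ω) (A : Matrix ι (Fin n) ℝ)
    (hA : (A * Aᵀ - ω ^ 2 • (1 : Matrix ι ι ℝ)).PosSemidef) (w : ι → ℝ) :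
    ∃ d : EuclideanSpace ℝ (Fin n), A *ᵥ d.ofLp = w ∧ ω ^ 2 * ‖d‖ ^ 2 ≤ ∑ᶠ i, w i ^ 2 := by
  have := Fintype.ofFinite ι
  have hG : (A * Aᵀ).PosDef := by
    have h1 : (ω ^ 2 • (1 : Matrix ι ι ℝ)).PosDef := Matrix.PosDef.one.smul (by positivity)
    simpa using Matrix.PosDef.posSemidef_add hA h1
  have hdet : IsUnit (A * Aᵀ).det := (Matrix.isUnit_iff_isUnit_det _).1 hG.isUnit
  set y := (A * Aᵀ)⁻¹ *ᵥ w with hy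
  have hGy : (A * Aᵀ) *ᵥ y = w := by
    rw [hy, Matrix.mulVec_mulVec, Matrix.mul_nonsing_inv _ hdet, Matrix.one_mulVec]
  -- The least-norm solution `Aᵀ (A Aᵀ)⁻¹ w`, whose squared norm is `y ⬝ᵥ w`.
  refine ⟨WithLp.toLp 2 (Aᵀ *ᵥ y), by rw [Matrix.mulVec_mulVec, hGy], ?_⟩
  have h1 : ‖WithLp.toLp 2 (Aᵀ *ᵥ y)‖ ^ 2 = y ⬝ᵥ w := by
    rw [EuclideanSpace.real_norm_sq_eq, ← hGy, ← Matrix.mulVec_mulVec, Matrix.dotProduct_mulVec,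
      ← Matrix.mulVec_transpose]
    simp [dotProduct, sq]
  have h2 : ω ^ 2 * (y ⬝ᵥ y) ≤ y ⬝ᵥ w := by
    have := hA.dotProduct_mulVec_nonneg y
    rw [Matrix.sub_mulVec, hGy, Matrix.smul_mulVec, Matrix.one_mulVec, dotProduct_sub,
      dotProduct_smul] at this
    simpa using this
  have h3 : 0 ≤ (w - ω ^ 2 • y) ⬝ᵥ (w - ω ^ 2 • y) :=
    Finset.sum_nonneg fun i _ => mul_self_nonneg _
  rw [sub_dotProduct, dotProduct_sub, dotProduct_sub, smul_dotProduct, smul_dotProduct,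
    dotProduct_smul, dotProduct_smul, dotProduct_comm w y] at h3
  simp only [smul_eq_mul] at h3
  rw [h1, finsum_eq_sum_of_fintype]
  have h4 : ∑ i, w i ^ 2 = w ⬝ᵥ w := by simp [dotProduct, sq]
  rw [h4]
  nlinarith [mul_le_mul_of_nonneg_left h2 (sq_nonneg ω)]

section Polyhedron

variable {m n : ℕ} {U : Matrix (Fin m) (Fin n) ℝ} {w w₀ : EuclideanSpace ℝ (Fin m)}
  {x₀ : EuclideanSpace ℝ (Fin n)} {ω : ℝ}

lemma continuous_mulVec_ofLp_apply (U : Matrix (Fin m) (Fin n) ℝ) (i : Fin m) :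
    Continuous fun x : EuclideanSpace ℝ (Fin n) => (U *ᵥ x.ofLp) i := by
  simp only [Matrix.mulVec, dotProduct]
  fun_prop

lemma isClosed_polyhedron (U : Matrix (Fin m) (Fin n) ℝ) (w : EuclideanSpace ℝ (Fin m)) :
    IsClosed (polyhedron U w) := by
  simp only [polyhedron, ofPred_forall]
  exact isClosed_iInter fun i => isClosed_le (continuous_mulVec_ofLp_apply U i) continuous_const

lemma convex_polyhedron (U : Matrix (Fin m) (Fin n) ℝ) (w : EuclideanSpace ℝ (Fin m)) :
    Convex ℝ (polyhedron U w) := by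
  intro x hx y hy a b ha hb hab i
  simp only [WithLp.ofLp_add, WithLp.ofLp_smul, Matrix.mulVec_add, Matrix.mulVec_smul, Pi.add_apply,
    Pi.smul_apply, smul_eq_mul]
  calc _ ≤ a * w i + b * w i := by gcongr; exacts [hx i, hy i]
    _ = w i := by rw [← add_mul, hab, one_mul]

/-- If `d` shifts the active constraints at `x₀` from `w₀` to `w`, then `x - (x₀ + d)` is a feasible
direction at `x₀` for every `x` satisfying the constraints `w`. -/
lemma exists_add_smul_mem_polyhedron {x d : EuclideanSpace ℝ (Fin n)} (hx₀ : x₀ ∈ polyhedron U w₀)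
    (hd : ∀ i ∈ activeSet U w₀ x₀, (U *ᵥ d.ofLp) i = w i - w₀ i) (hx : x ∈ polyhedron U w) :
    ∃ θ : ℝ, 0 < θ ∧ x₀ + θ • (x - x₀ - d) ∈ polyhedron U w₀ := by
  have key : ∀ᶠ θ : ℝ in 𝓝[>] 0, ∀ i, (U *ᵥ (x₀ + θ • (x - x₀ - d)).ofLp) i ≤ w₀ i := by
    rw [eventually_all]
    intro i
    by_cases hi : i ∈ activeSet U w₀ x₀
    -- On an active row the value is `w₀ i + θ ((U x) i - w i)`, so every `θ > 0` works; on an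
    -- inactive row the slack allows small `θ`.
    · filter_upwards [self_mem_nhdsWithin] with θ hθ
      have h1 := hd i hi
      have h2 : (U *ᵥ x₀.ofLp) i = w₀ i := hi
      have h3 := hx i
      simp only [WithLp.ofLp_add, WithLp.ofLp_smul, WithLp.ofLp_sub, Matrix.mulVec_add,
        Matrix.mulVec_smul, Matrix.mulVec_sub, Pi.add_apply, Pi.sub_apply, Pi.smul_apply,
        smul_eq_mul, h1, h2]
      nlinarith [mem_Ioi.1 hθ]
    · have hlt : (U *ᵥ x₀.ofLp) i < w₀ i := lt_of_le_of_ne (hx₀ i) hi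
      have hcont : Continuous fun θ : ℝ => (U *ᵥ (x₀ + θ • (x - x₀ - d)).ofLp) i :=
        (continuous_mulVec_ofLp_apply U i).comp (by fun_prop)
      have := hcont.tendsto 0
      simp only [zero_smul, add_zero] at this
      exact ((this.eventually_lt_const hlt).filter_mono nhdsWithin_le_nhds).mono fun _ h => h.le
  obtain ⟨θ, h1, h2⟩ := (key.and self_mem_nhdsWithin).exists
  exact ⟨θ, h2, h1⟩

/-- The rank condition solves `U d = w - w₀` on the active rows with `‖d‖` controlled by `1 / ω`.
Inactive rows have slack, which survives only a small change; hence the restriction to `w` near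
`w₀`. The two feasibility conclusions provide test points for the variational inequalities at `w`
and at `w₀`. -/
lemma eventually_exists_shift (hω : 0 < ω) (hx₀ : x₀ ∈ polyhedron U w₀)
    (hU : (rowsOf U (activeSet U w₀ x₀) * (rowsOf U (activeSet U w₀ x₀))ᵀ
        - ω ^ 2 • (1 : Matrix (activeSet U w₀ x₀) (activeSet U w₀ x₀) ℝ)).PosSemidef) :
    ∀ᶠ w in 𝓝 w₀, ∃ d : EuclideanSpace ℝ (Fin n), ‖d‖ ≤ ‖w - w₀‖ / ω ∧
      x₀ + d ∈ polyhedron U w ∧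
      ∀ x ∈ polyhedron U w, ∃ θ : ℝ, 0 < θ ∧ x₀ + θ • (x - x₀ - d) ∈ polyhedron U w₀ := by
  have hopen : ∀ᶠ p : EuclideanSpace ℝ (Fin n) × EuclideanSpace ℝ (Fin m) in 𝓝 (x₀, w₀),
      ∀ i, i ∉ activeSet U w₀ x₀ → (U *ᵥ p.1.ofLp) i < p.2 i := by
    rw [eventually_all]
    intro i
    by_cases hi : i ∈ activeSet U w₀ x₀
    · simp [hi]
    · have hlt : (U *ᵥ x₀.ofLp) i < w₀ i := lt_of_le_of_ne (hx₀ i) hi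
      have h1 : Continuous fun p : EuclideanSpace ℝ (Fin n) × EuclideanSpace ℝ (Fin m) =>
          (U *ᵥ p.1.ofLp) i := (continuous_mulVec_ofLp_apply U i).comp continuous_fst
      have h2 : Continuous fun p : EuclideanSpace ℝ (Fin n) × EuclideanSpace ℝ (Fin m) => p.2 i := by
        fun_prop
      exact ((h1.tendsto _).eventually_lt (h2.tendsto _) hlt).mono fun p hp _ => hp
  obtain ⟨ε, hε, hball⟩ := Metric.eventually_nhds_iff.1 hopen
  -- The radius `ε ω` ensures `‖d‖ < ε`.
  filter_upwards [Metric.ball_mem_nhds w₀ hε, Metric.ball_mem_nhds w₀ (mul_pos hε hω)] with w h1 h2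
  rw [Metric.mem_ball, dist_eq_norm] at h1 h2
  obtain ⟨d, hd, hdn⟩ := exists_mulVec_eq_of_posSemidef_sub hω _ hU
    (fun i => (w - w₀) (i : Fin m))
  have hd' : ∀ i ∈ activeSet U w₀ x₀, (U *ᵥ d.ofLp) i = w i - w₀ i :=
    fun i hi => congrFun hd ⟨i, hi⟩
  have hdn' : ‖d‖ ≤ ‖w - w₀‖ / ω := by
    rw [le_div_iff₀ hω]
    refine le_of_sq_le_sq ?_ (norm_nonneg _)
    have : ∑ᶠ i : activeSet U w₀ x₀, (w - w₀) (i : Fin m) ^ 2 ≤ ‖w - w₀‖ ^ 2 := by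
      rw [EuclideanSpace.real_norm_sq_eq, finsum_set_coe_eq_finsum_mem
        (f := fun i => (w - w₀) i ^ 2), finsum_mem_eq_finite_toFinset_sum _ (toFinite _)]
      exact Finset.sum_le_sum_of_subset_of_nonneg (Finset.subset_univ _)
        fun i _ _ => sq_nonneg _
    nlinarith
  refine ⟨d, hdn', fun i => ?_, fun x hx => exists_add_smul_mem_polyhedron hx₀ hd' hx⟩
  by_cases hi : i ∈ activeSet U w₀ x₀
  · have h3 : (U *ᵥ x₀.ofLp) i = w₀ i := hi
    simp [Matrix.mulVec_add, hd' i hi, h3]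
  · refine (hball (y := (x₀ + d, w)) ?_ i hi).le
    rw [Prod.dist_eq, max_lt_iff, dist_eq_norm, dist_eq_norm]
    refine ⟨?_, h1⟩
    rw [add_sub_cancel_left]
    exact hdn'.trans_lt ((div_lt_iff₀ hω).2 h2)

end Polyhedron

/-- The neighbourhood may depend on `s` but `K` does not, so a mean value inequality for right
slopes of `‖z τ - z s‖` makes the bound global. -/
lemma norm_sub_le_of_eventually_norm_sub_le {E : Type*} [NormedAddCommGroup E] {z : ℝ → E} {K : ℝ}
    (hz : ∀ s : ℝ, 0 ≤ s → ∀ᶠ t in 𝓝[Ici 0] s, ‖z t - z s‖ ≤ K * |t - s|)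
    {s t : ℝ} (hs : 0 ≤ s) (hst : s ≤ t) : ‖z t - z s‖ ≤ K * (t - s) := by
  have hcont : ContinuousOn z (Ici 0) := by
    intro s hs
    rw [ContinuousWithinAt, tendsto_iff_norm_sub_tendsto_zero]
    refine squeeze_zero' (Eventually.of_forall fun _ => norm_nonneg _) (hz s hs) ?_
    have : Continuous fun t : ℝ => K * |t - s| := by fun_prop
    simpa using (this.tendsto s).mono_left (nhdsWithin_le_nhds (s := Ici 0))
  have hcont' : ContinuousOn (fun τ => ‖z τ - z s‖) (Icc s t) :=
    ((hcont.mono fun τ hτ => hs.trans hτ.1).sub continuousOn_const).norm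
  refine image_le_of_liminf_slope_right_le_deriv_boundary (B := fun τ => K * (τ - s))
    (B' := fun _ => K) hcont' (by simp) (by fun_prop)
    (fun τ _ => by simpa using (((hasDerivAt_id τ).sub_const s).const_mul K).hasDerivWithinAt)
    (fun τ hτ r hr => ?_) (right_mem_Icc.2 hst)
  have hτ0 : 0 ≤ τ := hs.trans hτ.1
  refine Eventually.frequently ?_
  have := (hz τ hτ0).filter_mono (nhdsWithin_mono τ fun y (hy : τ < y) => hτ0.trans hy.le)
  filter_upwards [this, self_mem_nhdsWithin] with y hy hτy
  rw [mem_Ioi] at hτy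
  have hpos := sub_pos.2 hτy
  rw [abs_of_pos hpos] at hy
  rw [slope_def_field, div_lt_iff₀ hpos]
  have := norm_sub_le_norm_sub_add_norm_sub (z y) (z τ) (z s)
  nlinarith

/-! ### Lipschitz dependence of variational inequalities on the moving polyhedron. -/

section VariationalInequality

variable {m n : ℕ} {U : Matrix (Fin m) (Fin n) ℝ} {v : ℝ → EuclideanSpace ℝ (Fin m)}
  {α β ω : ℝ} {ℓv : ℝ≥0} {g : EuclideanSpace ℝ (Fin n) → EuclideanSpace ℝ (Fin n)}

/-- Solutions of a variational inequality over a moving polyhedron, whose operator is strongly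
monotone and cocoercive, depend in a Lipschitz way on the right hand side. -/
lemma norm_sub_le_of_variationalInequality (hα : 0 < α) (hβ : 0 ≤ β) (hω : 0 < ω)
    (hmono : ∀ x y, α * ‖x - y‖ ^ 2 ≤ inner ℝ (g x - g y) (x - y))
    (hcoc : ∀ x y, ‖g x - g y‖ ^ 2 ≤ β * inner ℝ (g x - g y) (x - y))
    (hv : LipschitzOnWith ℓv v (Ici 0))
    (hU : ∀ t : ℝ, 0 ≤ t → ∀ x ∈ polyhedron U (v t),
      (rowsOf U (activeSet U (v t) x) * (rowsOf U (activeSet U (v t) x))ᵀ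
        - ω ^ 2 • (1 : Matrix (activeSet U (v t) x) (activeSet U (v t) x) ℝ)).PosSemidef)
    {z : ℝ → EuclideanSpace ℝ (Fin n)} (hz : ∀ t : ℝ, 0 ≤ t → z t ∈ polyhedron U (v t))
    (hvi : ∀ t : ℝ, 0 ≤ t → ∀ y ∈ polyhedron U (v t), 0 ≤ inner ℝ (g (z t)) (y - z t))
    {s t : ℝ} (hs : 0 ≤ s) (ht : 0 ≤ t) :
    ‖z t - z s‖ ≤ √(β / α) * (ℓv / ω) * |t - s| := by
  wlog hst : s ≤ t generalizing s t
  · rw [norm_sub_rev, abs_sub_comm]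
    exact this ht hs (le_of_not_ge hst)
  rw [abs_of_nonneg (sub_nonneg.2 hst)]
  refine norm_sub_le_of_eventually_norm_sub_le (fun s hs => ?_) hs hst
  have hvs : Tendsto v (𝓝[Ici 0] s) (𝓝 (v s)) := hv.continuousOn s hs
  filter_upwards [hvs.eventually (eventually_exists_shift hω (hz s hs) (hU s hs _ (hz s hs))),
    self_mem_nhdsWithin] with t ⟨d, hd, hmem, hdir⟩ ht
  have ht : 0 ≤ t := ht
  have h1 : 0 ≤ inner ℝ (g (z s)) (z t - z s - d) := by
    obtain ⟨θ, hθ, hmem⟩ := hdir _ (hz t ht)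
    have := hvi s hs _ hmem
    rw [add_sub_cancel_left, inner_smul_right] at this
    exact nonneg_of_mul_nonneg_right this hθ
  have h2 := hvi t ht _ hmem
  have h3 : z s + d - z t = -(z t - z s - d) := by abel
  rw [h3, inner_neg_right] at h2
  have h4 : inner ℝ (g (z t) - g (z s)) (z t - z s) ≤ ‖g (z t) - g (z s)‖ * ‖d‖ := by
    refine le_trans ?_ (real_inner_le_norm _ _)
    have : inner ℝ (g (z t) - g (z s)) (z t - z s - d) ≤ 0 := by
      rw [inner_sub_left]; linarith
    rw [inner_sub_right] at this
    linarith
  have hm := hmono (z t) (z s)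
  have hc := hcoc (z t) (z s)
  set p : ℝ := inner ℝ (g (z t) - g (z s)) (z t - z s)
  have hp : 0 ≤ p := le_trans (by positivity) hm
  -- Square `p ≤ ‖Δg‖ ‖d‖`, bound `‖Δg‖ ^ 2` by `β p` and cancel `p`. This is the source of the
  -- square root in `√(β/α)`.
  have h5 : p ≤ β * ‖d‖ ^ 2 := by
    rcases hp.eq_or_lt with h | h
    · rw [← h]; positivity
    · have : p * p ≤ p * (β * ‖d‖ ^ 2) := by
        calc p * p ≤ (‖g (z t) - g (z s)‖ * ‖d‖) * (‖g (z t) - g (z s)‖ * ‖d‖) := by gcongr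
          _ = ‖g (z t) - g (z s)‖ ^ 2 * ‖d‖ ^ 2 := by ring
          _ ≤ (β * p) * ‖d‖ ^ 2 := by gcongr
          _ = _ := by ring
      exact le_of_mul_le_mul_left this h
  have h6 : ‖z t - z s‖ ≤ √(β / α) * ‖d‖ := by
    rw [← Real.sqrt_sq (norm_nonneg d), ← Real.sqrt_mul (by positivity)]
    refine Real.le_sqrt_of_sq_le ?_
    rw [div_mul_eq_mul_div, le_div_iff₀ hα]
    linarith
  have h7 : ‖v t - v s‖ ≤ ℓv * |t - s| := by
    simpa [dist_eq_norm] using hv.dist_le_mul t ht s hs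
  calc ‖z t - z s‖ ≤ √(β / α) * (‖v t - v s‖ / ω) := h6.trans (by gcongr)
    _ ≤ √(β / α) * (ℓv * |t - s| / ω) := by gcongr
    _ = _ := by ring

end VariationalInequality

/-- The projection onto a nonempty closed convex set. -/
lemma exists_forall_inner_sub_le_zero {E : Type*} [NormedAddCommGroup E] [InnerProductSpace ℝ E]
    [CompleteSpace E] {X : Set E} (hne : X.Nonempty) (hcl : IsClosed X) (hconv : Convex ℝ X)
    (u : E) : ∃ q ∈ X, ∀ y ∈ X, inner ℝ (u - q) (y - q) ≤ 0 := by
  obtain ⟨q, hq, h⟩ := exists_norm_eq_iInf_of_complete_convex hne hcl.isComplete hconv u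
  exact ⟨q, hq, (norm_eq_iInf_iff_real_inner_le_zero hconv hq).1 h⟩

/-- The moving polyhedron is Lipschitz continuous for the Hausdorff distance. -/
lemma exists_mem_polyhedron_norm_sub_le {m n : ℕ} {U : Matrix (Fin m) (Fin n) ℝ}
    {v : ℝ → EuclideanSpace ℝ (Fin m)} {ω : ℝ} {ℓv : ℝ≥0} (hω : 0 < ω)
    (hv : LipschitzOnWith ℓv v (Ici 0))
    (hU : ∀ t : ℝ, 0 ≤ t → ∀ x ∈ polyhedron U (v t),
      (rowsOf U (activeSet U (v t) x) * (rowsOf U (activeSet U (v t) x))ᵀ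
        - ω ^ 2 • (1 : Matrix (activeSet U (v t) x) (activeSet U (v t) x) ℝ)).PosSemidef)
    (hne : ∀ t : ℝ, 0 ≤ t → (polyhedron U (v t)).Nonempty)
    {s t : ℝ} (hs : 0 ≤ s) (ht : 0 ≤ t) {p : EuclideanSpace ℝ (Fin n)}
    (hp : p ∈ polyhedron U (v s)) :
    ∃ q ∈ polyhedron U (v t), ‖q - p‖ ≤ ℓv / ω * |t - s| := by
  have hproj : ∀ τ : ℝ, ∃ q, 0 ≤ τ → q ∈ polyhedron U (v τ) ∧
      ∀ y ∈ polyhedron U (v τ), inner ℝ (p - q) (y - q) ≤ 0 := by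
    intro τ
    by_cases hτ : 0 ≤ τ
    · obtain ⟨q, hq⟩ := exists_forall_inner_sub_le_zero (hne τ hτ) (isClosed_polyhedron U (v τ))
        (convex_polyhedron U (v τ)) p
      exact ⟨q, fun _ => hq⟩
    · exact ⟨0, fun h => absurd h hτ⟩
  choose z hz using hproj
  have hzs : z s = p := by
    have := (hz s hs).2 p hp
    rw [real_inner_self_eq_norm_sq] at this
    have h0 : ‖p - z s‖ = 0 := by nlinarith [norm_nonneg (p - z s)]
    exact (sub_eq_zero.1 (norm_eq_zero.1 h0)).symm
  refine ⟨z t, (hz t ht).1, ?_⟩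
  -- `z τ` is the projection of `p` at time `τ`, which solves the variational inequality of `x - p`;
  -- here `√(β/α) = 1`, and the path equals `p` at time `s`.
  have := norm_sub_le_of_variationalInequality (α := 1) (β := 1) (g := fun x => x - p) one_pos
    zero_le_one hω (fun x y => by simp)
    (fun x y => by simp) hv hU (fun τ hτ => (hz τ hτ).1)
    (fun τ hτ y hy => by
      have := (hz τ hτ).2 y hy
      rw [← neg_sub, inner_neg_left] at this
      linarith) hs ht
  simpa [hzs] using this

/-! ### Existence of solutions by the catching-up scheme. -/

section CatchingUp

variable {E : Type*} [NormedAddCommGroup E] [InnerProductSpace ℝ E]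
  {Φ : E → ℝ → E} {X : ℝ → Set E} {x₀ : E} {h B L : ℝ} {y : ℕ → E}

/-- The catching-up scheme with step `h` for `ẋ ∈ Φ x t - N_{x} X(t)`:
an explicit Euler step followed by a projection onto the next position of the moving set. -/
structure IsCatchingUp (Φ : E → ℝ → E) (X : ℝ → Set E) (x₀ : E) (h : ℝ) (y : ℕ → E) : Prop where
  zero : y 0 = x₀
  mem : ∀ j : ℕ, y j ∈ X (j * h)
  inner_le : ∀ j : ℕ, ∀ q ∈ X ((j + 1 : ℕ) * h),
    inner ℝ (y j + h • Φ (y j) (j * h) - y (j + 1)) (q - y (j + 1)) ≤ 0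

lemma exists_isCatchingUp [CompleteSpace E] (Φ : E → ℝ → E)
    (hne : ∀ t : ℝ, 0 ≤ t → (X t).Nonempty)
    (hcl : ∀ t : ℝ, 0 ≤ t → IsClosed (X t)) (hconv : ∀ t : ℝ, 0 ≤ t → Convex ℝ (X t))
    (hx₀ : x₀ ∈ X 0) (hh : 0 ≤ h) : ∃ y : ℕ → E, IsCatchingUp Φ X x₀ h y := by
  have hproj : ∀ (u : E) (j : ℕ), ∃ q ∈ X (j * h), ∀ w ∈ X (j * h), inner ℝ (u - q) (w - q) ≤ 0 :=
    fun u j => exists_forall_inner_sub_le_zero (hne _ (by positivity)) (hcl _ (by positivity))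
      (hconv _ (by positivity)) u
  choose P hP hP' using hproj
  let y : ℕ → E := fun j => Nat.rec x₀ (fun j z => P (z + h • Φ z (j * h)) (j + 1)) j
  refine ⟨y, rfl, fun j => ?_, fun j => hP' _ _⟩
  cases j with
  | zero => simpa [y] using hx₀
  | succ j => exact hP _ _

variable (hX : ∀ s t : ℝ, 0 ≤ s → 0 ≤ t → ∀ p ∈ X s, ∃ q ∈ X t, ‖q - p‖ ≤ L * |t - s|)
  (hΦ : ∀ x y : E, ∀ s t : ℝ, 0 ≤ s → 0 ≤ t → ‖Φ x t - Φ y s‖ ≤ B * (‖x - y‖ + |t - s|))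

include hX in
-- The next set has a point within `L h` of `y j`, and the projection of the Euler point is no
-- farther from it than that point; the Euler step is then counted twice.
lemma IsCatchingUp.norm_succ_sub_le (hy : IsCatchingUp Φ X x₀ h y) (hh : 0 < h) (j : ℕ) :
    ‖y (j + 1) - y j‖ ≤ h * (2 * ‖Φ (y j) (j * h)‖ + L) := by
  obtain ⟨q, hq, hqy⟩ := hX (j * h) ((j + 1 : ℕ) * h) (by positivity) (by positivity) _ (hy.mem j)
  have h1 : |((j + 1 : ℕ) : ℝ) * h - j * h| = h := by
    push_cast
    rw [add_mul, add_sub_cancel_left, one_mul, abs_of_pos hh]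
  rw [h1] at hqy
  have h2 := hy.inner_le j q hq
  set u := y j + h • Φ (y j) (j * h) with hu
  have h3 : ‖u - y (j + 1)‖ ≤ ‖u - q‖ := by
    refine le_of_sq_le_sq ?_ (norm_nonneg _)
    have : u - q = (u - y (j + 1)) - (q - y (j + 1)) := by abel
    rw [this, norm_sub_sq_real (u - y (j + 1))]
    nlinarith [sq_nonneg ‖q - y (j + 1)‖]
  have h4 : ‖u - y j‖ = h * ‖Φ (y j) (j * h)‖ := by
    rw [hu, add_sub_cancel_left, norm_smul, Real.norm_of_nonneg hh.le]
  have h5 : ‖u - q‖ ≤ ‖u - y j‖ + ‖y j - q‖ := norm_sub_le_norm_sub_add_norm_sub _ _ _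
  have h6 : ‖y (j + 1) - y j‖ ≤ ‖y (j + 1) - u‖ + ‖u - y j‖ := norm_sub_le_norm_sub_add_norm_sub _ _ _
  rw [norm_sub_rev _ u] at h6
  rw [norm_sub_rev (y j) q] at h5
  linarith

include hX hΦ in
/-- A priori bounds for the catching-up scheme, uniform in the step size. -/
lemma exists_isCatchingUp_bound (hB : 0 ≤ B) (hL : 0 ≤ L) (x₀ : E) (T : ℝ) :
    ∃ M : ℝ, 0 ≤ M ∧ ∀ h : ℝ, 0 < h → ∀ y : ℕ → E, IsCatchingUp Φ X x₀ h y → ∀ j : ℕ, j * h ≤ T →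
      ‖y j - x₀‖ ≤ M ∧ ‖Φ (y j) (j * h)‖ ≤ M ∧ ‖y (j + 1) - y j‖ ≤ M * h := by
  set K : ℝ := 2 * ‖Φ x₀ 0‖ + L + 1 with hK
  set D : ℝ := K * Real.exp ((2 * B + 1) * T) with hD
  have hK1 : 0 < K := by positivity
  have hD0 : 0 < D := by positivity
  refine ⟨D + 2 * (‖Φ x₀ 0‖ + B * D) + L, by positivity, fun h hh y hy j hj => ?_⟩
  have hΦj : ∀ j : ℕ, ‖Φ (y j) (j * h)‖ ≤ ‖Φ x₀ 0‖ + B * (‖y j - x₀‖ + j * h) := by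
    intro j
    have h1 := hΦ (y j) x₀ 0 (j * h) le_rfl (by positivity)
    rw [sub_zero, abs_of_nonneg (by positivity : (0 : ℝ) ≤ j * h)] at h1
    have h2 := norm_le_norm_add_norm_sub' (Φ (y j) (j * h)) (Φ x₀ 0)
    linarith
  -- Discrete Grönwall: adding `K` absorbs the constant terms, so each step multiplies the left side
  -- by at most `1 + (2 B + 1) h`.
  have hgrow : ∀ j : ℕ, ‖y j - x₀‖ + j * h + K ≤ K * Real.exp ((2 * B + 1) * (j * h)) := by
    intro j
    induction j with
    | zero => simp [hy.zero]
    | succ j ih =>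
      have h1 := hy.norm_succ_sub_le hX hh j
      have h2 : ‖y (j + 1) - x₀‖ ≤ ‖y (j + 1) - y j‖ + ‖y j - x₀‖ :=
        norm_sub_le_norm_sub_add_norm_sub _ _ _
      have h3 := hΦj j
      have h4 : 0 ≤ B * K := by positivity
      have h5 : ‖y (j + 1) - y j‖ + h ≤ h * ((2 * B + 1) * (‖y j - x₀‖ + j * h + K)) := by
        have h6 : 0 ≤ ‖y j - x₀‖ + j * h := by positivity
        calc ‖y (j + 1) - y j‖ + h ≤ h * (2 * ‖Φ (y j) (j * h)‖ + L) + h := by linarith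
          _ = h * (2 * ‖Φ (y j) (j * h)‖ + L + 1) := by ring
          _ ≤ h * ((2 * B + 1) * (‖y j - x₀‖ + j * h + K)) := by gcongr; linarith
      calc ‖y (j + 1) - x₀‖ + ((j + 1 : ℕ) : ℝ) * h + K
          ≤ (‖y j - x₀‖ + j * h + K) * (1 + (2 * B + 1) * h) := by push_cast; linarith
        _ ≤ (K * Real.exp ((2 * B + 1) * (j * h))) * Real.exp ((2 * B + 1) * h) := by
          gcongr
          linarith [Real.add_one_le_exp ((2 * B + 1) * h)]
        _ = _ := by
          rw [mul_assoc, ← Real.exp_add]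
          push_cast
          ring_nf
  have hb : ‖y j - x₀‖ + j * h + K ≤ D := (hgrow j).trans (by rw [hD]; gcongr)
  have hjh : 0 ≤ j * h := by positivity
  have h1 : ‖Φ (y j) (j * h)‖ ≤ ‖Φ x₀ 0‖ + B * D := (hΦj j).trans (by gcongr; linarith)
  have h2 : 0 ≤ ‖Φ x₀ 0‖ + B * D := by positivity
  refine ⟨by linarith, by linarith, (hy.norm_succ_sub_le hX hh j).trans ?_⟩
  rw [mul_comm]
  gcongr
  linarith

omit [InnerProductSpace ℝ E] in
lemma norm_sub_le_of_forall_norm_succ_sub_le {M T : ℝ} {i k : ℕ}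
    (hM : ∀ j : ℕ, j * h ≤ T → ‖y (j + 1) - y j‖ ≤ M * h) (hh : 0 ≤ h) (hik : i ≤ k)
    (hk : k * h ≤ T) : ‖y k - y i‖ ≤ M * (k * h - i * h) := by
  induction k, hik using Nat.le_induction with
  | base => simp
  | succ k hik ih =>
    push_cast at hk ⊢
    have hk' : k * h ≤ T := by linarith
    have h1 := norm_sub_le_norm_sub_add_norm_sub (y (k + 1)) (y k) (y i)
    linarith [ih hk', hM k hk']

include hX hΦ in
/-- The discrete evolution variational inequality. -/
lemma exists_isCatchingUp_energy (hB : 0 ≤ B) (hL : 0 ≤ L) (x₀ p : E) (T : ℝ) :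
    ∃ C : ℝ, ∀ h : ℝ, 0 < h → ∀ y : ℕ → E, IsCatchingUp Φ X x₀ h y → ∀ t₀ : ℝ, 0 ≤ t₀ → p ∈ X t₀ →
      ∀ i k : ℕ, i ≤ k → k * h ≤ T → i * h ≤ t₀ → t₀ ≤ (i + 1) * h →
      ‖y k - p‖ ^ 2 - ‖y i - p‖ ^ 2 ≤
        2 * (k * h - i * h) * inner ℝ (Φ (y i) (i * h)) (y i - p) + C * (k * h - i * h) ^ 2 := by
  obtain ⟨M, hM0, hM⟩ := exists_isCatchingUp_bound hX hΦ hB hL x₀ T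
  set C : ℝ := 2 * (B * (M + 1) * (M + ‖x₀ - p‖) + M * M) + 4 * M * L with hC
  refine ⟨C, fun h hh y hy t₀ ht₀ hp i k hik hk hi hi' => ?_⟩
  set τ := (k : ℝ) * h - i * h with hτ
  have hcast : ∀ {a b : ℕ}, a ≤ b → (a : ℝ) * h ≤ b * h := fun hab => by gcongr
  have hτ0 : 0 ≤ τ := sub_nonneg.2 (hcast hik)
  set G : ℝ := inner ℝ (Φ (y i) (i * h)) (y i - p) with hG
  have hlip : ∀ j, i ≤ j → j ≤ k → ‖y j - y i‖ ≤ M * τ := fun j hij hjk =>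
    (norm_sub_le_of_forall_norm_succ_sub_le (fun j hj => (hM h hh y hy j hj).2.2) hh.le hij
      ((hcast hjk).trans hk)).trans (by gcongr; linarith [hcast hjk])
  have hstep : ∀ j, i ≤ j → j + 1 ≤ k →
      ‖y (j + 1) - p‖ ^ 2 - ‖y j - p‖ ^ 2 ≤ h * (2 * G + C * τ) := by
    intro j hij hjk
    have hjT : j * h ≤ T := (hcast (Nat.le_of_succ_le hjk)).trans hk
    obtain ⟨-, hΦj, hyj⟩ := hM h hh y hy j hjT
    obtain ⟨-, hΦi, -⟩ := hM h hh y hy i ((hcast hik).trans hk)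
    have hys := (hM h hh y hy (j + 1) ((hcast hjk).trans hk)).1
    have htj : t₀ ≤ ((j + 1 : ℕ) : ℝ) * h := hi'.trans (by
      have := hcast (Nat.succ_le_succ hij)
      push_cast at this ⊢
      exact this)
    have hτj : (j : ℝ) * h - i * h ≤ τ := by linarith [hcast (Nat.le_of_succ_le hjk)]
    -- `p` need not be admissible at the new time; it is replaced by a nearby `q`, at a cost of
    -- order `τ`.
    obtain ⟨q, hq, hqp⟩ := hX t₀ ((j + 1 : ℕ) * h) ht₀ (by positivity) p hp
    have hqp' : ‖q - p‖ ≤ L * τ := by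
      refine hqp.trans ?_
      rw [abs_of_nonneg (sub_nonneg.2 htj)]
      gcongr
      linarith [hcast hjk]
    have h1 : ‖y (j + 1) - p‖ ^ 2 - ‖y j - p‖ ^ 2 ≤
        2 * (h * inner ℝ (Φ (y j) (j * h)) (y (j + 1) - p)) + 4 * M * L * τ * h := by
      have hproj := hy.inner_le j q hq
      set a := y (j + 1) - y j with ha
      have e1 : y j - p = (y (j + 1) - p) - a := by rw [ha]; abel
      have e2 : y j + h • Φ (y j) (j * h) - y (j + 1) = h • Φ (y j) (j * h) - a := by rw [ha]; abel
      have e3 : q - y (j + 1) = (q - p) - (y (j + 1) - p) := by abel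
      rw [e1, norm_sub_sq_real (y (j + 1) - p) a, real_inner_comm]
      rw [e2, e3, inner_sub_left, inner_sub_right _ (q - p), inner_sub_right _ (q - p),
        real_inner_smul_left, real_inner_smul_left] at hproj
      have c1 : |inner ℝ (Φ (y j) (j * h)) (q - p)| ≤ M * (L * τ) :=
        (abs_real_inner_le_norm _ _).trans (by gcongr)
      have c2 : |inner ℝ a (q - p)| ≤ M * h * (L * τ) :=
        (abs_real_inner_le_norm _ _).trans (by gcongr)
      have c3 := mul_le_mul_of_nonneg_left (abs_le.1 c1).1 hh.le
      have c4 := (abs_le.1 c2).2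
      nlinarith [sq_nonneg ‖a‖]
    -- Freezing the field and the position at step `i` costs another term of order `τ`, so the
    -- errors sum to order `τ ^ 2`.
    have h2 : inner ℝ (Φ (y j) (j * h)) (y (j + 1) - p) ≤
        G + (B * (M + 1) * (M + ‖x₀ - p‖) + M * M) * τ := by
      have e1 : inner ℝ (Φ (y j) (j * h)) (y (j + 1) - p) = G
          + inner ℝ (Φ (y j) (j * h) - Φ (y i) (i * h)) (y (j + 1) - p)
          + inner ℝ (Φ (y i) (i * h)) (y (j + 1) - y i) := by
        simp only [hG, inner_sub_left, inner_sub_right]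
        ring
      have c1 : ‖Φ (y j) (j * h) - Φ (y i) (i * h)‖ ≤ B * (M * τ + τ) := by
        refine (hΦ _ _ _ _ (by positivity) (by positivity)).trans ?_
        rw [abs_of_nonneg (sub_nonneg.2 (hcast hij))]
        gcongr
        exact hlip j hij (Nat.le_of_succ_le hjk)
      have c2 : ‖y (j + 1) - p‖ ≤ M + ‖x₀ - p‖ :=
        (norm_sub_le_norm_sub_add_norm_sub _ x₀ _).trans (by gcongr)
      have c3 : inner ℝ (Φ (y j) (j * h) - Φ (y i) (i * h)) (y (j + 1) - p) ≤
          B * (M * τ + τ) * (M + ‖x₀ - p‖) := (real_inner_le_norm _ _).trans (by gcongr)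
      have c4 : inner ℝ (Φ (y i) (i * h)) (y (j + 1) - y i) ≤ M * (M * τ) :=
        (real_inner_le_norm _ _).trans
          (by gcongr; exact hlip (j + 1) (Nat.le_succ_of_le hij) hjk)
      rw [e1]
      linarith
    have h3 := mul_le_mul_of_nonneg_left h2 hh.le
    rw [hC]
    linarith
  have hsum : ∀ l, i ≤ l → l ≤ k →
      ‖y l - p‖ ^ 2 - ‖y i - p‖ ^ 2 ≤ (l * h - i * h) * (2 * G + C * τ) := by
    intro l hil
    induction l, hil using Nat.le_induction with
    | base => simp
    | succ l hil ih =>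
      intro hlk
      have h1 := ih (Nat.le_of_succ_le hlk)
      have h2 := hstep l hil hlk
      push_cast
      linarith
  have := hsum k hik le_rfl
  rw [← hτ] at this
  linarith

omit [InnerProductSpace ℝ E] in
include hX in
-- Each `ξ i` can be moved into `X t` by a vanishing displacement, and `X t` is closed.
lemma mem_of_tendsto_of_mem {ι : Type*} {l : Filter ι} [l.NeBot] {s : ι → ℝ} {ξ : ι → E} {t : ℝ}
    {x : E} (ht : 0 ≤ t) (hcl : IsClosed (X t)) (hs : Tendsto s l (𝓝 t)) (hξ : Tendsto ξ l (𝓝 x))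
    (hs0 : ∀ i, 0 ≤ s i) (hmem : ∀ i, ξ i ∈ X (s i)) : x ∈ X t := by
  choose q hq hqξ using fun i => hX (s i) t (hs0 i) ht _ (hmem i)
  refine hcl.mem_of_tendsto (f := q) (b := l) ?_ (Eventually.of_forall hq)
  have h1 : Tendsto (fun i => L * |t - s i|) l (𝓝 0) := by
    simpa using ((tendsto_const_nhds (x := t)).sub hs).abs.const_mul L
  have h2 := squeeze_zero_norm hqξ h1
  simpa using h2.add hξ

include hX hΦ in
/-- Pointwise limits of the catching-up scheme along an ultrafilter. -/
lemma exists_forall_energy_le [ProperSpace E] (hB : 0 ≤ B) (hL : 0 ≤ L)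
    (hne : ∀ t : ℝ, 0 ≤ t → (X t).Nonempty)
    (hcl : ∀ t : ℝ, 0 ≤ t → IsClosed (X t)) (hconv : ∀ t : ℝ, 0 ≤ t → Convex ℝ (X t))
    (hx₀ : x₀ ∈ X 0) :
    ∃ x : ℝ → E, x 0 = x₀ ∧ (∀ t : ℝ, 0 ≤ t → x t ∈ X t) ∧
      (∀ T : ℝ, ∃ M : ℝ≥0, LipschitzOnWith M x (Icc 0 T)) ∧
      ∀ T t₀ : ℝ, 0 ≤ t₀ → ∀ p ∈ X t₀, ∃ C : ℝ, ∀ t ∈ Icc t₀ T,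
        ‖x t - p‖ ^ 2 - ‖x t₀ - p‖ ^ 2 ≤
          2 * (t - t₀) * inner ℝ (Φ (x t₀) t₀) (x t₀ - p) + C * (t - t₀) ^ 2 := by
  set h : ℕ → ℝ := fun N => 1 / ((N : ℝ) + 1) with hh
  have hpos : ∀ N, 0 < h N := fun N => by positivity
  have hlim : Tendsto h atTop (𝓝 0) := tendsto_one_div_add_atTop_nhds_zero_nat
  choose y hy using fun N => exists_isCatchingUp Φ hne hcl hconv hx₀ (hpos N).le
  -- For `t ≥ 0`, the last grid time not after `t`.
  set σ : ℕ → ℝ → ℝ := fun N t => ⌊t / h N⌋₊ * h N with hσ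
  have hσ0 : ∀ N t, 0 ≤ σ N t := fun N t => mul_nonneg (Nat.cast_nonneg _) (hpos N).le
  have hσle : ∀ N t, 0 ≤ t → σ N t ≤ t := fun N t ht =>
    (le_div_iff₀ (hpos N)).1 (Nat.floor_le (div_nonneg ht (hpos N).le))
  have hσlt : ∀ N t, t ≤ (⌊t / h N⌋₊ + 1) * h N := fun N t =>
    ((div_lt_iff₀ (hpos N)).1 (Nat.lt_floor_add_one _)).le
  -- A free ultrafilter gives limits of bounded sequences at all times simultaneously, with no
  -- subsequence extraction.
  let F : Ultrafilter ℕ := hyperfilter ℕ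
  have hF : (F : Filter ℕ) ≤ atTop := by
    rw [← Nat.cofinite_eq_atTop]
    exact hyperfilter_le_cofinite
  have hσt : ∀ t, 0 ≤ t → Tendsto (fun N => σ N t) F (𝓝 t) := by
    intro t ht
    refine Tendsto.mono_left ?_ hF
    refine tendsto_of_tendsto_of_tendsto_of_le_of_le (g := fun N => t - h N)
      (by simpa using (tendsto_const_nhds (x := t)).sub hlim) tendsto_const_nhds (fun N => ?_)
      fun N => hσle N t ht
    have := hσlt N t
    simp only [hσ]
    linarith
  have hx : ∀ t : ℝ, ∃ x : E, 0 ≤ t → Tendsto (fun N => y N ⌊t / h N⌋₊) F (𝓝 x) := by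
    intro t
    by_cases ht : 0 ≤ t
    · obtain ⟨M, -, hM⟩ := exists_isCatchingUp_bound hX hΦ hB hL x₀ t
      have hball : ∀ N, y N ⌊t / h N⌋₊ ∈ Metric.closedBall x₀ M := fun N => by
        rw [mem_closedBall_iff_norm]
        exact (hM _ (hpos N) _ (hy N) _ (hσle N t ht)).1
      obtain ⟨x, -, hx⟩ := (isCompact_closedBall x₀ M).ultrafilter_le_nhds
        (F.map fun N => y N ⌊t / h N⌋₊)
        (le_principal_iff.2 (Filter.mem_map.2 (univ_mem' hball)))
      exact ⟨x, fun _ => hx⟩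
    · exact ⟨0, fun h => absurd h ht⟩
  choose x hx using hx
  have hmono : ∀ N {s t : ℝ}, s ≤ t → ⌊s / h N⌋₊ ≤ ⌊t / h N⌋₊ := fun N s t hst =>
    Nat.floor_le_floor (div_le_div_of_nonneg_right hst (hpos N).le)
  refine ⟨x, ?_, fun t ht => ?_, fun T => ?_, fun T t₀ ht₀ p hp => ?_⟩
  · refine tendsto_nhds_unique (hx 0 le_rfl) ?_
    simp [(hy _).zero]
  · exact mem_of_tendsto_of_mem hX ht (hcl t ht) (hσt t ht) (hx t ht) (fun N => hσ0 N t)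
      fun N => (hy N).mem _
  · obtain ⟨M, hM0, hM⟩ := exists_isCatchingUp_bound hX hΦ hB hL x₀ T
    have key : ∀ s t : ℝ, 0 ≤ s → s ≤ t → t ≤ T → ‖x t - x s‖ ≤ M * (t - s) := by
      intro s t hs hst htT
      refine le_of_tendsto_of_tendsto ((hx t (hs.trans hst)).sub (hx s hs)).norm
        (((hσt t (hs.trans hst)).sub (hσt s hs)).const_mul M) (Eventually.of_forall fun N => ?_)
      exact norm_sub_le_of_forall_norm_succ_sub_le
        (fun j hj => (hM _ (hpos N) _ (hy N) j hj).2.2) (hpos N).le (hmono N hst)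
        ((hσle N t (hs.trans hst)).trans htT)
    refine ⟨M.toNNReal, LipschitzOnWith.of_dist_le_mul fun s hs t ht => ?_⟩
    rw [Real.coe_toNNReal M hM0, dist_eq_norm, Real.dist_eq]
    rcases le_total s t with hst | hst
    · rw [norm_sub_rev, abs_sub_comm, abs_of_nonneg (sub_nonneg.2 hst)]
      exact key s t hs.1 hst ht.2
    · rw [abs_of_nonneg (sub_nonneg.2 hst)]
      exact key t s ht.1 hst hs.2
  · obtain ⟨C, hC⟩ := exists_isCatchingUp_energy hX hΦ hB hL x₀ p T
    refine ⟨C, fun t ht => ?_⟩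
    have ht0 : 0 ≤ t := ht₀.trans ht.1
    have hΦt : Tendsto (fun N => Φ (y N ⌊t₀ / h N⌋₊) (σ N t₀)) F (𝓝 (Φ (x t₀) t₀)) := by
      rw [tendsto_iff_norm_sub_tendsto_zero]
      refine squeeze_zero (fun _ => norm_nonneg _)
        (fun N => hΦ _ (x t₀) t₀ (σ N t₀) ht₀ (hσ0 N t₀)) ?_
      have h1 := ((hx t₀ ht₀).sub_const (x t₀)).norm
      have h2 := ((hσt t₀ ht₀).sub_const t₀).abs
      simpa using (h1.add h2).const_mul B
    have hst := (hσt t ht0).sub (hσt t₀ ht₀)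
    refine le_of_tendsto_of_tendsto
      ((((hx t ht0).sub_const p).norm.pow 2).sub (((hx t₀ ht₀).sub_const p).norm.pow 2))
      (((hst.const_mul 2).mul (hΦt.inner ((hx t₀ ht₀).sub_const p))).add ((hst.pow 2).const_mul C))
      (Eventually.of_forall fun N => ?_)
    exact hC _ (hpos N) _ (hy N) t₀ ht₀ hp _ _ (hmono N ht.1) ((hσle N t ht0).trans ht.2)
      (hσle N t₀ ht₀) (hσlt N t₀)

end CatchingUp

/-- Existence of complete solutions of perturbed sweeping processes. -/
lemma exists_isCompleteSweepingSolution {n : ℕ}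
    {Φ : EuclideanSpace ℝ (Fin n) → ℝ → EuclideanSpace ℝ (Fin n)}
    {X : ℝ → Set (EuclideanSpace ℝ (Fin n))} {B L : ℝ} (hB : 0 ≤ B) (hL : 0 ≤ L)
    (hX : ∀ s t : ℝ, 0 ≤ s → 0 ≤ t → ∀ p ∈ X s, ∃ q ∈ X t, ‖q - p‖ ≤ L * |t - s|)
    (hΦ : ∀ x y, ∀ s t : ℝ, 0 ≤ s → 0 ≤ t → ‖Φ x t - Φ y s‖ ≤ B * (‖x - y‖ + |t - s|))
    (hne : ∀ t : ℝ, 0 ≤ t → (X t).Nonempty)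
    (hcl : ∀ t : ℝ, 0 ≤ t → IsClosed (X t)) (hconv : ∀ t : ℝ, 0 ≤ t → Convex ℝ (X t))
    {x₀ : EuclideanSpace ℝ (Fin n)} (hx₀ : x₀ ∈ X 0) :
    ∃ x : ℝ → EuclideanSpace ℝ (Fin n), x 0 = x₀ ∧ IsCompleteSweepingSolution Φ X x := by
  obtain ⟨x, hx0, hmem, hlip, henergy⟩ := exists_forall_energy_le hX hΦ hB hL hne hcl hconv hx₀
  refine ⟨x, hx0, fun T hT => ?_⟩
  obtain ⟨M, hM⟩ := hlip T
  refine ⟨LipschitzOnWith.absolutelyContinuousOnInterval (by rwa [uIcc_of_le hT.le]),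
    fun t ht => hmem t ht.1, ?_⟩
  rw [ae_restrict_iff' measurableSet_Icc]
  have h0 : ∀ᵐ t : ℝ, t ≠ 0 := Measure.ae_ne volume 0
  have hTne : ∀ᵐ t : ℝ, t ≠ T := Measure.ae_ne volume T
  filter_upwards [hM.ae_differentiableWithinAt_of_mem_real, h0, hTne] with t hdiff ht0 htT ht
  have htIoo : t ∈ Ioo 0 T := ⟨lt_of_le_of_ne ht.1 (Ne.symm ht0), lt_of_le_of_ne ht.2 htT⟩
  have hd : HasDerivAt x (deriv x t) t :=
    ((hdiff ht).differentiableAt (Icc_mem_nhds htIoo.1 htIoo.2)).hasDerivAt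
  -- The normal vector is forced. Dividing the energy inequality by the elapsed time removes its
  -- quadratic error, even though `C` depends on `p`.
  refine ⟨Φ (x t) t - deriv x t, subset_closure fun p hp => ?_, by simpa using hd⟩
  obtain ⟨C, hC⟩ := henergy T t ht.1 p hp
  have h1 := ((hd.sub_const p).norm_sq).tendsto_slope_zero_right
  have h2 : Tendsto (fun r : ℝ => 2 * inner ℝ (Φ (x t) t) (x t - p) + C * r) (𝓝[>] 0)
      (𝓝 (2 * inner ℝ (Φ (x t) t) (x t - p) + C * 0)) :=
    (Continuous.tendsto (by fun_prop) 0).mono_left nhdsWithin_le_nhds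
  have h3 := le_of_tendsto_of_tendsto h1 h2 (by
    filter_upwards [Ioo_mem_nhdsGT (sub_pos.2 htIoo.2)] with r hr
    rw [smul_eq_mul, inv_mul_le_iff₀ hr.1]
    have := hC (t + r) ⟨by linarith [hr.1], by linarith [hr.2]⟩
    rw [add_sub_cancel_left] at this
    linarith)
  rw [← neg_sub (x t) p, inner_neg_right, inner_sub_left, real_inner_comm _ (deriv x t)]
  linarith

/-! ### Exponential tracking of a Lipschitz target. -/

lemma AbsolutelyContinuousOnInterval.norm {F : Type*} [SeminormedAddCommGroup F] {f : ℝ → F}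
    {a b : ℝ} (hf : AbsolutelyContinuousOnInterval f a b) :
    AbsolutelyContinuousOnInterval (fun t => ‖f t‖) a b :=
  squeeze_zero (fun _ => Finset.sum_nonneg fun _ _ => dist_nonneg)
    (fun _ => Finset.sum_le_sum fun _ _ => by
      rw [dist_eq_norm (f _)]
      exact dist_norm_norm_le _ _) hf

lemma AbsolutelyContinuousOnInterval.le_of_ae_deriv_nonpos {f : ℝ → ℝ} {a b : ℝ}
    (hf : AbsolutelyContinuousOnInterval f a b) (hab : a ≤ b)
    (hderiv : ∀ᵐ t : ℝ, t ∈ Icc a b → deriv f t ≤ 0) : f b ≤ f a := by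
  rw [← sub_nonpos, ← hf.integral_deriv_eq_sub, intervalIntegral.integral_of_le hab]
  refine integral_nonpos_of_ae ?_
  rw [EventuallyLE, ae_restrict_iff' measurableSet_Ioc]
  filter_upwards [hderiv] with t ht h
  exact ht (Ioc_subset_Icc_self h)

section Tracking

variable {E : Type*} [NormedAddCommGroup E] [InnerProductSpace ℝ E] {x z : ℝ → E} {α K : ℝ}

/-- Since `z` need not be differentiable, it is frozen at `z t` and its motion is charged to `K` in
the right difference quotient. Where the two curves meet, the distance has a minimum and zero
derivative. -/
lemma deriv_norm_sub_le {t : ℝ} {x' : E} (hK : 0 ≤ K) (hx : HasDerivAt x x' t)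
    (hx' : inner ℝ x' (x t - z t) ≤ -α * ‖x t - z t‖ ^ 2)
    (hz : ∀ s : ℝ, t ≤ s → ‖z s - z t‖ ≤ K * (s - t))
    (he : DifferentiableAt ℝ (fun s => ‖x s - z s‖) t) :
    deriv (fun s => ‖x s - z s‖) t ≤ K - α * ‖x t - z t‖ := by
  rcases eq_or_ne (x t) (z t) with h | h
  · have hmin : IsLocalMin (fun s => ‖x s - z s‖) t :=
      Eventually.of_forall fun s => by simp [h]
    rw [hmin.deriv_eq_zero]
    simpa [h] using hK
  · have hpos : 0 < ‖x t - z t‖ := norm_pos_iff.2 (sub_ne_zero.2 h)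
    have h1 : HasDerivAt (fun s => ‖x s - z t‖) (inner ℝ x' (x t - z t) / ‖x t - z t‖) t := by
      have h2 := ((hx.sub_const (z t)).norm_sq).sqrt (by positivity)
      simp only [Real.sqrt_sq (norm_nonneg _)] at h2
      refine h2.congr_deriv ?_
      rw [real_inner_comm]
      field_simp
    have h2 : Tendsto (fun r : ℝ => r⁻¹ • (‖x (t + r) - z t‖ - ‖x t - z t‖) + K) (𝓝[>] 0)
        (𝓝 (inner ℝ x' (x t - z t) / ‖x t - z t‖ + K)) :=
      h1.tendsto_slope_zero_right.add_const K
    have h3 := le_of_tendsto_of_tendsto he.hasDerivAt.tendsto_slope_zero_right h2 (by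
      filter_upwards [self_mem_nhdsWithin] with r hr
      have hr : 0 < r := hr
      have h4 := hz (t + r) (by linarith)
      rw [add_sub_cancel_left] at h4
      have h5 := norm_sub_le_norm_sub_add_norm_sub (x (t + r)) (z t) (z (t + r))
      rw [norm_sub_rev (z t)] at h5
      simp only [smul_eq_mul]
      rw [inv_mul_le_iff₀ hr, mul_add, mul_inv_cancel_left₀ hr.ne']
      linarith)
    refine h3.trans ?_
    have : inner ℝ x' (x t - z t) / ‖x t - z t‖ ≤ -α * ‖x t - z t‖ := by
      rw [div_le_iff₀ hpos]
      linarith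
    linarith

/-- Exponential tracking of a `K`-Lipschitz target by an `α`-contracting trajectory. -/
lemma exp_mul_norm_sub_le (hα : 0 < α) (hK : 0 ≤ K) {s t : ℝ} (hs : 0 ≤ s) (hst : s ≤ t)
    (hac : AbsolutelyContinuousOnInterval x 0 t)
    (hx : ∀ᵐ τ : ℝ, τ ∈ Icc 0 t →
      ∃ x' : E, HasDerivAt x x' τ ∧ inner ℝ x' (x τ - z τ) ≤ -α * ‖x τ - z τ‖ ^ 2)
    (hz : ∀ a b : ℝ, 0 ≤ a → 0 ≤ b → ‖z b - z a‖ ≤ K * |b - a|) :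
    Real.exp (α * t) * (‖x t - z t‖ - K / α) ≤ Real.exp (α * s) * (‖x s - z s‖ - K / α) := by
  have hsub : uIcc s t ⊆ Icc 0 t := by
    rw [uIcc_of_le hst]
    exact Icc_subset_Icc_left hs
  have hzac : AbsolutelyContinuousOnInterval z s t := by
    refine LipschitzOnWith.absolutelyContinuousOnInterval (K := K.toNNReal)
      (LipschitzOnWith.of_dist_le_mul fun a ha b hb => ?_)
    rw [Real.coe_toNNReal K hK, dist_eq_norm, Real.dist_eq]
    exact hz b a (hsub hb).1 (hsub ha).1
  have hxac : AbsolutelyContinuousOnInterval x s t :=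
    hac.mono (by rwa [uIcc_of_le (hs.trans hst)])
  have heac : AbsolutelyContinuousOnInterval (fun τ => ‖x τ - z τ‖) s t := (hxac.sub hzac).norm
  have hexp : AbsolutelyContinuousOnInterval (fun τ => Real.exp (α * τ)) s t :=
    ContDiffOn.absolutelyContinuousOnInterval (by fun_prop)
  have hconst : AbsolutelyContinuousOnInterval (fun _ : ℝ => K / α) s t :=
    ContDiffOn.absolutelyContinuousOnInterval (by fun_prop)
  refine (hexp.mul (heac.sub hconst)).le_of_ae_deriv_nonpos hst ?_
  filter_upwards [hx, heac.ae_differentiableAt] with τ hxτ hdiff hτ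
  have hτ' : τ ∈ Icc 0 t := Icc_subset_Icc_left hs hτ
  obtain ⟨x', hx', hle⟩ := hxτ hτ'
  have hd := hdiff (by rwa [uIcc_of_le hst])
  have h1 := deriv_norm_sub_le hK hx' hle (fun b hb => by
    simpa [abs_of_nonneg (sub_nonneg.2 hb)] using hz τ b hτ'.1 (hτ'.1.trans hb)) hd
  have h2 : HasDerivAt (fun τ => Real.exp (α * τ)) (Real.exp (α * τ) * α) τ := by
    simpa using ((hasDerivAt_id τ).const_mul α).exp
  have h3 := h2.mul (hd.hasDerivAt.sub_const (K / α))
  refine le_of_eq_of_le h3.deriv ?_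
  have h4 : Real.exp (α * τ) * α * (‖x τ - z τ‖ - K / α)
      = Real.exp (α * τ) * (α * ‖x τ - z τ‖ - K) := by field_simp
  rw [h4, ← mul_add]
  exact mul_nonpos_of_nonneg_of_nonpos (Real.exp_pos _).le (by linarith)

/-- The hypothesis bounds `e t` by `R` plus a decaying exponential. Working in `EReal` avoids
boundedness side conditions on the limsup. -/
lemma limsup_le_of_exp_mul_sub_le {e : ℝ → ℝ} {R : ℝ} (hα : 0 < α)
    (he : ∀ t : ℝ, 0 ≤ t → Real.exp (α * t) * (e t - R) ≤ e 0 - R) :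
    limsup (fun t : ℝ => ((e t : ℝ) : EReal)) atTop ≤ (R : EReal) := by
  have h1 : Tendsto (fun t : ℝ => R + (e 0 - R) * Real.exp (-(α * t))) atTop
      (𝓝 (R + (e 0 - R) * 0)) :=
    ((Real.tendsto_exp_neg_atTop_nhds_zero.comp (tendsto_id.const_mul_atTop hα)).const_mul
      _).const_add R
  have h2 : Tendsto (fun t : ℝ => ((R + (e 0 - R) * Real.exp (-(α * t)) : ℝ) : EReal)) atTop
      (𝓝 (R : EReal)) := by
    rw [mul_zero, add_zero] at h1
    exact (continuous_coe_real_ereal.tendsto _).comp h1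
  rw [← h2.limsup_eq]
  refine limsup_le_limsup ?_
  filter_upwards [eventually_ge_atTop 0] with t ht
  rw [EReal.coe_le_coe_iff]
  have := mul_le_mul_of_nonneg_right (he t ht) (Real.exp_pos (-(α * t))).le
  rw [mul_right_comm, ← Real.exp_add, add_neg_cancel, Real.exp_zero, one_mul] at this
  linarith

end Tracking

/-! ### Comparison of constants and optimizers, and the main theorem. -/

/-- A Lipschitz field dominating a strongly monotone one has the larger constant. -/
lemma le_of_strongly_monotone_of_lipschitz {E : Type*} [NormedAddCommGroup E]
    [InnerProductSpace ℝ E] [Nontrivial E] {g : E → E} {α : ℝ} {β : ℝ≥0}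
    (hmono : ∀ x y, α * ‖x - y‖ ^ 2 ≤ inner ℝ (g x - g y) (x - y)) (hβ : LipschitzWith β g) :
    α ≤ β := by
  obtain ⟨x, y, hxy⟩ := exists_pair_ne E
  have hpos : 0 < ‖x - y‖ := norm_pos_iff.2 (sub_ne_zero.2 hxy)
  have h1 := (hmono x y).trans (real_inner_le_norm _ _)
  have h2 := hβ.dist_le_mul x y
  rw [dist_eq_norm, dist_eq_norm] at h2
  have h3 : α * ‖x - y‖ ^ 2 ≤ β * ‖x - y‖ ^ 2 := by nlinarith
  exact le_of_mul_le_mul_right h3 (by positivity)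

/-- Solutions of two variational inequalities over the same set. -/
lemma norm_sub_le_of_variationalInequality_shift {E : Type*} [NormedAddCommGroup E]
    [InnerProductSpace ℝ E] {g : E → E} {α : ℝ} {β : ℝ≥0} (hα : 0 < α)
    (hmono : ∀ x y, α * ‖x - y‖ ^ 2 ≤ inner ℝ (g x - g y) (x - y)) (hβ : LipschitzWith β g)
    {a b x y : E} (hx : 0 ≤ inner ℝ (g (x - a)) (y - x)) (hy : 0 ≤ inner ℝ (g (y - b)) (x - y)) :
    ‖x - y‖ ≤ β / α * ‖a - b‖ := by
  have h1 := hmono (x - a) (y - a)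
  rw [sub_sub_sub_cancel_right, inner_sub_left] at h1
  rw [← neg_sub x y, inner_neg_right] at hx
  have h2 := real_inner_le_norm (g (y - b) - g (y - a)) (x - y)
  rw [inner_sub_left] at h2
  have h3 := hβ.dist_le_mul (y - b) (y - a)
  rw [dist_eq_norm, dist_eq_norm, sub_sub_sub_cancel_left] at h3
  have h4 : α * ‖x - y‖ ^ 2 ≤ β * ‖a - b‖ * ‖x - y‖ := by
    nlinarith [mul_le_mul_of_nonneg_right h3 (norm_nonneg (x - y))]
  rcases (norm_nonneg (x - y)).eq_or_lt with h | h
  · rw [← h]; positivity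
  · rw [div_mul_eq_mul_div, le_div_iff₀ hα]
    refine le_of_mul_le_mul_right ?_ h
    linarith

/-- The defining inequality for a fixed `y` cuts out a closed half-space, so it survives the
closure. -/
lemma inner_nonpos_of_mem_normalCone {n : ℕ} {X : Set (EuclideanSpace ℝ (Fin n))}
    {x y η : EuclideanSpace ℝ (Fin n)} (hη : η ∈ normalCone X x) (hy : y ∈ X) :
    inner ℝ η (y - x) ≤ 0 := by
  have hcl : IsClosed {η : EuclideanSpace ℝ (Fin n) | inner ℝ η (y - x) ≤ 0} :=
    isClosed_le (by fun_prop) continuous_const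
  refine closure_minimal ?_ hcl hη
  intro ζ (hζ : ∀ y ∈ X, inner ℝ ζ (y - x) ≤ 0)
  exact hζ y hy

theorem mainTheorem8 {n m : ℕ}
    (f : EuclideanSpace ℝ (Fin n) → ℝ)
    (c : ℝ → EuclideanSpace ℝ (Fin n)) (v : ℝ → EuclideanSpace ℝ (Fin m))
    (U : Matrix (Fin m) (Fin n) ℝ)
    (α ω : ℝ) (β ℓc ℓv : ℝ≥0) (hα : 0 < α) (hω : 0 < ω)
    (hf : ContDiff ℝ 2 f) (hfα : StrongConvexOn univ α f) (hfβ : LipschitzWith β (∇ f))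
    (hc : LipschitzOnWith ℓc c (Ici 0)) (hv : LipschitzOnWith ℓv v (Ici 0))
    (hU : ∀ t : ℝ, 0 ≤ t → ∀ x ∈ polyhedron U (v t),
      (rowsOf U (activeSet U (v t) x) * (rowsOf U (activeSet U (v t) x))ᵀ
        - ω ^ 2 • (1 : Matrix (activeSet U (v t) x) (activeSet U (v t) x) ℝ)).PosSemidef)
    (hne : ∀ t : ℝ, 0 ≤ t → (polyhedron U (v t)).Nonempty) :
    ∃ xs : ℝ → EuclideanSpace ℝ (Fin n),
      -- `xs t` is the unique optimizer at time `t`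
      (∀ t : ℝ, 0 ≤ t →
        IsOptimizer (fun x => f (x - c t)) (polyhedron U (v t)) (xs t) ∧
        ∀ y, IsOptimizer (fun x => f (x - c t)) (polyhedron U (v t)) y → y = xs t) ∧
      -- complete solutions exist from every feasible initial point
      (∀ x₀ ∈ polyhedron U (v 0), ∃ x : ℝ → EuclideanSpace ℝ (Fin n), x 0 = x₀ ∧
        IsCompleteSweepingSolution (fun z t => -∇ f (z - c t)) (fun t => polyhedron U (v t)) x) ∧
      -- every complete solution satisfies the tracking bound and the invariance property
      (∀ x : ℝ → EuclideanSpace ℝ (Fin n),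
        IsCompleteSweepingSolution (fun z t => -∇ f (z - c t)) (fun t => polyhedron U (v t)) x →
        limsup (fun t : ℝ => ((‖x t - xs t‖ : ℝ) : EReal)) atTop ≤
          (((β : ℝ) ^ (1 / 2 : ℝ) / α ^ (3 / 2 : ℝ) * (β * ℓc / α + ℓv / ω) : ℝ) : EReal) ∧
        ∀ s : ℝ, 0 ≤ s →
          ‖x s - xs s‖ ≤ (β : ℝ) ^ (1 / 2 : ℝ) / α ^ (3 / 2 : ℝ) * (β * ℓc / α + ℓv / ω) →
          ∀ t : ℝ, s ≤ t →
            ‖x t - xs t‖ ≤ (β : ℝ) ^ (1 / 2 : ℝ) / α ^ (3 / 2 : ℝ) * (β * ℓc / α + ℓv / ω)) := by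
  have hd : Differentiable ℝ f := hf.differentiable (by norm_num)
  have hmono := hfα.strongly_monotone_gradient hd
  have hcoc := sq_norm_gradient_sub_le hd (hfα.mono hα.le) hfβ
  -- first order conditions, for an arbitrary shift
  have hopt : ∀ (a : EuclideanSpace ℝ (Fin n)) (t : ℝ), ∃ x, 0 ≤ t →
      IsOptimizer (fun x => f (x - a)) (polyhedron U (v t)) x := by
    intro a t
    by_cases ht : 0 ≤ t
    · obtain ⟨x, hx, hmin⟩ := hfα.exists_forall_le hd hα
        (X := (fun x => x + a) ⁻¹' polyhedron U (v t))
        ((isClosed_polyhedron U (v t)).preimage (by fun_prop))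
        (by obtain ⟨p, hp⟩ := hne t ht; exact ⟨p - a, by simpa using hp⟩)
      exact ⟨x + a, fun _ => ⟨hx, fun y hy => by
        simpa using hmin (y - a) (by simpa using hy)⟩⟩
    · exact ⟨0, fun h => absurd h ht⟩
  have hvi : ∀ {a x : EuclideanSpace ℝ (Fin n)} {t : ℝ},
      IsOptimizer (fun x => f (x - a)) (polyhedron U (v t)) x →
      ∀ y ∈ polyhedron U (v t), 0 ≤ inner ℝ (∇ f (x - a)) (y - x) := by
    intro a x t hx y hy
    have := inner_gradient_nonneg_of_isMinOn hd (X := (fun x => x + a) ⁻¹' polyhedron U (v t))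
      (x := x - a) (y := y - a)
      ((convex_polyhedron U (v t)).translate_preimage_left a) (by simpa using hx.1)
      (fun z hz => by simpa using hx.2 (z + a) hz) (by simpa using hy)
    simpa using this
  -- Treating the shift `a` as independent of time separates the effects of `c` and `v`; the
  -- optimizer is `S (c t) t`.
  choose S hS using hopt
  have hSv : ∀ (a : EuclideanSpace ℝ (Fin n)) (s t : ℝ), 0 ≤ s → 0 ≤ t →
      ‖S a t - S a s‖ ≤ √(β / α) * (ℓv / ω) * |t - s| := fun a s t hs ht =>
    norm_sub_le_of_variationalInequality (g := fun x => ∇ f (x - a)) hα β.coe_nonneg hω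
      (fun x y => by simpa using hmono (x - a) (y - a))
      (fun x y => by simpa using hcoc (x - a) (y - a)) hv hU (fun t ht => (hS a t ht).1)
      (fun t ht => hvi (hS a t ht)) hs ht
  have hSc : ∀ (a b : EuclideanSpace ℝ (Fin n)) (t : ℝ), 0 ≤ t →
      ‖S a t - S b t‖ ≤ β / α * ‖a - b‖ := fun a b t ht =>
    norm_sub_le_of_variationalInequality_shift hα hmono hfβ
      (hvi (hS a t ht) _ (hS b t ht).1) (hvi (hS b t ht) _ (hS a t ht).1)
  have hcl : ∀ s t : ℝ, 0 ≤ s → 0 ≤ t → ‖c t - c s‖ ≤ ℓc * |t - s| := fun s t hs ht => by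
    simpa [dist_eq_norm] using hc.dist_le_mul t ht s hs
  set K : ℝ := √(β / α) * (β * ℓc / α + ℓv / ω) with hK
  have hK0 : 0 ≤ K := by positivity
  have hR : (β : ℝ) ^ (1 / 2 : ℝ) / α ^ (3 / 2 : ℝ) * (β * ℓc / α + ℓv / ω) = K / α := by
    have h1 : α ^ (3 / 2 : ℝ) = α * √α := by
      rw [Real.sqrt_eq_rpow, show (3 / 2 : ℝ) = 1 + 1 / 2 by norm_num, Real.rpow_add hα,
        Real.rpow_one]
    rw [h1, ← Real.sqrt_eq_rpow, hK, Real.sqrt_div β.coe_nonneg]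
    field_simp
  have hlip : ∀ s t : ℝ, 0 ≤ s → 0 ≤ t → ‖S (c t) t - S (c s) s‖ ≤ K * |t - s| := by
    intro s t hs ht
    -- `α ≤ β` needs two distinct points. It gives `√(β/α) ≥ 1`, which lets the `c` term carry the
    -- same prefactor as the `v` term.
    rcases subsingleton_or_nontrivial (EuclideanSpace ℝ (Fin n)) with _ | _
    · rw [Subsingleton.elim (S (c t) t) (S (c s) s), sub_self, norm_zero]
      positivity
    have hαβ : α ≤ β := le_of_strongly_monotone_of_lipschitz hmono hfβ
    have h1 : 1 ≤ √(β / α) := Real.one_le_sqrt.2 ((one_le_div hα).2 hαβ)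
    calc ‖S (c t) t - S (c s) s‖
        ≤ ‖S (c t) t - S (c s) t‖ + ‖S (c s) t - S (c s) s‖ :=
          norm_sub_le_norm_sub_add_norm_sub _ _ _
      _ ≤ β / α * (ℓc * |t - s|) + √(β / α) * (ℓv / ω) * |t - s| := by
          gcongr
          · exact (hSc _ _ t ht).trans (by gcongr; exact hcl s t hs ht)
          · exact hSv _ s t hs ht
      _ = 1 * (β * ℓc / α * |t - s|) + √(β / α) * (ℓv / ω) * |t - s| := by ring
      _ ≤ √(β / α) * (β * ℓc / α * |t - s|) + √(β / α) * (ℓv / ω) * |t - s| := by gcongr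
      _ = K * |t - s| := by rw [hK]; ring
  have htrack : ∀ x : ℝ → EuclideanSpace ℝ (Fin n),
      IsCompleteSweepingSolution (fun z t => -∇ f (z - c t)) (fun t => polyhedron U (v t)) x →
      ∀ s t : ℝ, 0 ≤ s → s ≤ t → Real.exp (α * t) * (‖x t - S (c t) t‖ - K / α) ≤
        Real.exp (α * s) * (‖x s - S (c s) s‖ - K / α) := by
    intro x hx s t hs hst
    -- Solutions are only specified on intervals of positive length, so `t = 0` is separate.
    rcases (hs.trans hst).eq_or_lt with h0 | h0
    · rw [le_antisymm hst (h0 ▸ hs)]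
    obtain ⟨hac, hmem, hinc⟩ := hx t h0
    refine exp_mul_norm_sub_le (z := fun t => S (c t) t) hα hK0 hs hst hac ?_ hlip
    rw [ae_restrict_iff' measurableSet_Icc] at hinc
    filter_upwards [hinc] with τ hτ hτt
    obtain ⟨η, hη, hderiv⟩ := hτ hτt
    refine ⟨_, hderiv, ?_⟩
    have hSτ := hS (c τ) τ hτt.1
    -- Contraction: the normal cone is tested with the optimizer and the optimality condition with
    -- the solution; strong monotonicity supplies the rest.
    have h1 := inner_nonpos_of_mem_normalCone hη hSτ.1
    have h2 := hvi hSτ _ (hmem τ hτt)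
    have h3 := hmono (x τ - c τ) (S (c τ) τ - c τ)
    rw [sub_sub_sub_cancel_right, inner_sub_left] at h3
    rw [← neg_sub (x τ), inner_neg_right] at h1
    rw [inner_sub_left, inner_neg_left]
    linarith
  rw [hR]
  refine ⟨fun t => S (c t) t, fun t ht => ⟨hS _ t ht, fun y hy => ?_⟩, fun x₀ hx₀ => ?_,
    fun x hx => ⟨?_, fun s hs hxs t hst => ?_⟩⟩
  · have := norm_sub_le_of_variationalInequality_shift hα hmono hfβ
      (hvi hy _ (hS (c t) t ht).1) (hvi (hS (c t) t ht) _ hy.1)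
    rw [sub_self, norm_zero, mul_zero] at this
    exact sub_eq_zero.1 (norm_le_zero_iff.1 this)
  -- The field varies by at most `β (‖x - y‖ + ℓc |t - s|)`, which `B` dominates jointly in space
  -- and time.
  · refine exists_isCompleteSweepingSolution (B := β * (1 + ℓc)) (L := ℓv / ω) (by positivity)
      (by positivity)
      (fun s t hs ht p hp => exists_mem_polyhedron_norm_sub_le hω hv hU hne hs ht hp)
      (fun x y s t hs ht => ?_) hne (fun t _ => isClosed_polyhedron U (v t))
      (fun t _ => convex_polyhedron U (v t)) hx₀
    have h1 := hfβ.dist_le_mul (x - c t) (y - c s)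
    rw [dist_eq_norm, dist_eq_norm, sub_sub_sub_comm] at h1
    rw [neg_sub_neg, norm_sub_rev]
    have h2 := (norm_sub_le (x - y) (c t - c s)).trans (add_le_add_right (hcl s t hs ht) _)
    refine h1.trans ?_
    rw [mul_assoc]
    gcongr
    refine h2.trans ?_
    nlinarith [mul_nonneg ℓc.coe_nonneg (norm_nonneg (x - y)), abs_nonneg (t - s)]
  · refine limsup_le_of_exp_mul_sub_le (e := fun t => ‖x t - S (c t) t‖) hα fun t ht => ?_
    simpa using htrack x hx 0 t le_rfl ht
  · have h1 := (htrack x hx s t hs hst).trans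
      (mul_nonpos_of_nonneg_of_nonpos (Real.exp_pos _).le (sub_nonpos.2 hxs))
    exact sub_nonpos.1 (nonpos_of_mul_nonpos_right h1 (Real.exp_pos _))
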